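/- Let $n>1$ be an odd integer and let $p_2,\dots,p_n:\mathbb{R}\to\mathbb{C}$ be $1$-periodic PT-symmetric functions ($\overline{p_v(-x)}=p_v(x)$) such that $p_v,\dots,p_v^{(n-v-1)}$ are locally absolutely continuous and $p_v^{(n-v)}\in L_2[0,1]$. For $t\in(-1,1]$ let $L_t$ be the operator in $L_2[0,1]$ generated by $$l(y)=(-i)^n y^{(n)}+\sum_{v=2}^n(-i)^{n-v}p_v\,y^{(n-v)}$$ and the boundary conditions $y^{(\nu)}(1)=e^{i\pi t}y^{(\nu)}(0)$, $\nu=0,1,\dots,n-1$; its domain consists of the $y$ satisfying these conditions for which $y,\dots,y^{(n-1)}$ are absolutely continuous on $[0,1]$ and $y^{(n)}\in L_2[0,1]$. Let $L_t(0)$ be the operator $L_t$ with all $p_v=0$, and put $L_{t,\varepsilon}=L_t(0)+\varepsilon(L_t-L_t(0))$ for $\varepsilon\in[0,1]$. Let $$C=\sum_{v=2}^n\sum_{s=0}^{n-v}\frac{(n-v)!\,\|p_v^{(s)}\|}{s!\,(n-v-s)!\,\pi^{v+s-2}},$$ where $\|\cdot\|$ is the norm of $L_2[0,1]$. Define the open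 disks $$U(0,t)=\{\lambda\in\mathbb{C}:|\lambda-(\pi t)^n|<\tfrac15\pi^n\},$$ $$U(\pm1,t)=\{\lambda\in\mathbb{C}:|\lambda-(\pi t\pm2\pi)^n|<\tfrac{3}{10}|t\pm2|^{n-2}\pi^n\},$$ $$U(k,t)=\{\lambda\in\mathbb{C}:|\lambda-(2\pi k+\pi t)^n|<\tfrac32\pi^{n-2}C|2k+t|^{n-2}\}\quad(k\in\mathbb{Z},\ |k|>1).$$ Suppose that $C\le\pi^2 2^{-n+1/2}$ and let $t\in(-1,1]$. If $C\neq0$ (that is, if the $p_v$ do not all vanish almost everywhere), then for every $\varepsilon\in[0,1]$ every eigenvalue of $L_{t,\varepsilon}$ lies in $\bigcup_{k\in\mathbb{Z}}U(k,t)$. Moreover (also if $C=0$), the closures of the disks $U(k,t)$, $k\in\mathbb{Z}$, are pairwise disjoint. -/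

import Mathlib

open MeasureTheory

noncomputable section

namespace OddOrderBloch

/-- Lebesgue measure on `[0,1]`. -/
abbrev unitMeasure : Measure ℝ := volume.restrict (Set.Icc 0 1)

/-- The norm of `L₂[0,1]`. -/
def l2norm (f : ℝ → ℂ) : ℝ := (eLpNorm f 2 unitMeasure).toReal

/-- `f : ℝ → ℂ` is `1`-periodic, PT-symmetric, and `f⁽ᵐ⁾ ∈ L₂[0,1]`
(`f, …, f⁽ᵐ⁻¹⁾` exist and are locally absolutely continuous on `ℝ`). -/
structure IsCoefficient (m : ℕ) (f : ℝ → ℂ) : Prop where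
  periodic : Function.Periodic f 1
  pt_symm : ∀ x, star (f (-x)) = f x
  contDiff : ∀ j < m, ContDiff ℝ j f
  absCont : ∀ j < m, ∀ a b : ℝ, AbsolutelyContinuousOnInterval (iteratedDeriv j f) a b
  memLp : MemLp (iteratedDeriv m f) 2 unitMeasure

/-- The constant `C`, the sum over `2 ≤ v ≤ n` and `0 ≤ s ≤ n - v` of
`(n-v)! ‖p_v⁽ˢ⁾‖ / (s! (n-v-s)! π^(v+s-2))`. -/
def constC (n : ℕ) (p : ℕ → ℝ → ℂ) : ℝ :=
  ∑ v ∈ Finset.Icc 2 n, ∑ s ∈ Finset.range (n - v + 1),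
    ((n - v).factorial * l2norm (iteratedDeriv s (p v))) /
      (s.factorial * (n - v - s).factorial * Real.pi ^ (v + s - 2))

/-- The `j`-th derivative on `[0,1]` (one-sided at the end points). -/
def der (j : ℕ) (y : ℝ → ℂ) : ℝ → ℂ := iteratedDerivWithin j y (Set.Icc 0 1)

/-- The differential expression
`l(y) = (-i)ⁿ y⁽ⁿ⁾ + ∑ v ∈ {2,…,n}, (-i)ⁿ⁻ᵛ p_v y⁽ⁿ⁻ᵛ⁾` on `[0,1]`. -/
def diffExpr (n : ℕ) (p : ℕ → ℝ → ℂ) (y : ℝ → ℂ) (x : ℝ) : ℂ :=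
  (-Complex.I) ^ n * der n y x +
    ∑ v ∈ Finset.Icc 2 n, (-Complex.I) ^ (n - v) * p v x * der (n - v) y x

/-- The common domain of the operators `L_t` and `L_t(0)` (it does not depend on the coefficients):
`y, …, y⁽ⁿ⁻¹⁾` are absolutely continuous on `[0,1]`, `y⁽ⁿ⁾ ∈ L₂[0,1]`, and
`y⁽ᵛ⁾(1) = e^{iπt} y⁽ᵛ⁾(0)` for `v = 0, …, n-1`. -/
structure InDomain (n : ℕ) (t : ℝ) (y : ℝ → ℂ) : Prop where
  contDiffOn : ∀ j < n, ContDiffOn ℝ j y (Set.Icc 0 1)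
  absCont : ∀ j < n, AbsolutelyContinuousOnInterval (der j y) 0 1
  memLp : MemLp (der n y) 2 unitMeasure
  boundary : ∀ j < n, der j y 1 = Complex.exp (Complex.I * Real.pi * t) * der j y 0

/-- The action of `L_{t,ε} = L_t(0) + ε (L_t - L_t(0))`. -/
def homotopyExpr (n : ℕ) (p : ℕ → ℝ → ℂ) (ε : ℝ) (y : ℝ → ℂ) (x : ℝ) : ℂ :=
  diffExpr n 0 y x + ε * (diffExpr n p y x - diffExpr n 0 y x)

/-- `lam` is an eigenvalue of the operator `L_{t,ε}` in `L₂[0,1]`: some element `y` of its domain,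
nonzero in `L₂[0,1]`, satisfies `L_{t,ε} y = lam y` in `L₂[0,1]`. -/
def IsEigenvalue (n : ℕ) (p : ℕ → ℝ → ℂ) (t ε : ℝ) (lam : ℂ) : Prop :=
  ∃ y : ℝ → ℂ, InDomain n t y ∧ ¬ (y =ᵐ[unitMeasure] 0) ∧
    homotopyExpr n p ε y =ᵐ[unitMeasure] fun x => lam * y x

/-- The radius of the disk with index `k`. -/
def diskRadius (n : ℕ) (C t : ℝ) (k : ℤ) : ℝ :=
  if k = 0 then 1 / 5 * Real.pi ^ n
  else if k = 1 ∨ k = -1 then 3 / 10 * |2 * (k : ℝ) + t| ^ (n - 2) * Real.pi ^ n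
  else 3 / 2 * Real.pi ^ (n - 2) * C * |2 * (k : ℝ) + t| ^ (n - 2)

/-- The open disk `U(k,t)` with centre `(2πk + πt)ⁿ`. -/
def disk (n : ℕ) (C t : ℝ) (k : ℤ) : Set ℂ :=
  {lam : ℂ | ‖lam - (((2 * Real.pi * k + Real.pi * t) ^ n : ℝ) : ℂ)‖ < diskRadius n C t k}

end OddOrderBloch

end

noncomputable section

/-! Pair the eigenvalue equation with the plane wave of frequency `ω_k = freq t k = π(2k+t)`. The
leading term gives `ω_k^n`, so `(lam - ω_k^n) coeff t y k` equals `ε` times a sum of integrals of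
`p_v y^(n-v) wave`. Integrating by parts moves all derivatives off `y`; boundary terms cancel
because the wave undoes the phase `e^{iπt}` and `p_v` is periodic. By Cauchy-Schwarz, `|lam - ω_k^n|
|coeff_k| ≤ π^(n-2) weight C ‖y‖` (`InDomain.norm_sub_mul_norm_coeff_le`), and `C` is the constant
this produces.

Put `c = C/π²` and `D k = |lam - ω_k^n|/π^n`. If `lam` is in no disk, Parseval (`hasSum_sq_coeff`)
gives `‖y‖² ≤ ‖y‖² ∑ (c weight/D k)²`. The hypothesis on `C` and `n ≥ 3` give `c² ≤ 1/32`, which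
makes the sum less than one (`exists_majorant`), a contradiction.

Disjointness is a comparison of neighbouring centres, all real, with the radii
(`pow_add_scaledRadius_lt`). -/

namespace OddOrderBloch

/-! ### Complex-valued absolutely continuous functions -/

section AbsolutelyContinuous

variable {a b : ℝ}

lemma absolutelyContinuousOnInterval_clm_comp (L : ℂ →L[ℝ] ℝ) {h : ℝ → ℂ}
    (hh : AbsolutelyContinuousOnInterval h a b) :
    AbsolutelyContinuousOnInterval (fun x => L (h x)) a b := by
  apply squeeze_zero (fun t => ?_) (fun t => ?_) (by simpa using Filter.Tendsto.const_mul ‖L‖ hh)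
  · exact Finset.sum_nonneg fun i _ => dist_nonneg
  · rw [Finset.mul_sum]
    gcongr
    rw [dist_eq_norm, dist_eq_norm, ← map_sub]
    exact L.le_opNorm _

lemma ae_differentiableAt_of_absolutelyContinuousOnInterval {h : ℝ → ℂ}
    (hh : AbsolutelyContinuousOnInterval h a b) :
    ∀ᵐ x, x ∈ Set.uIcc a b → DifferentiableAt ℝ h x := by
  filter_upwards [(absolutelyContinuousOnInterval_clm_comp Complex.reCLM hh).ae_differentiableAt,
    (absolutelyContinuousOnInterval_clm_comp Complex.imCLM hh).ae_differentiableAt]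
    with x h₁ h₂ hx
  have e : h = fun x => ((Complex.reCLM (h x) : ℝ) : ℂ)
      + ((Complex.imCLM (h x) : ℝ) : ℂ) * Complex.I := by
    funext x
    simp
  rw [e]
  exact (Complex.ofRealCLM.differentiableAt.comp x (h₁ hx)).add
    ((Complex.ofRealCLM.differentiableAt.comp x (h₂ hx)).mul_const _)

/-- The fundamental theorem of calculus for complex valued absolutely continuous functions. -/
lemma integral_eq_sub_of_absolutelyContinuousOnInterval {h h' : ℝ → ℂ}
    (hh : AbsolutelyContinuousOnInterval h a b) (hi : IntervalIntegrable h' volume a b)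
    (hd : ∀ᵐ x, x ∈ Set.uIoc a b → HasDerivAt h (h' x) x) :
    ∫ x in a..b, h' x = h b - h a := by
  -- It suffices to test against real functionals, of which the real and imaginary parts determine
  -- the value.
  have key : ∀ L : ℂ →L[ℝ] ℝ, L (∫ x in a..b, h' x) = L (h b - h a) := by
    intro L
    rw [← L.intervalIntegral_comp_comm hi, map_sub,
      ← (absolutelyContinuousOnInterval_clm_comp L hh).integral_deriv_eq_sub]
    apply intervalIntegral.integral_congr_ae
    filter_upwards [hd] with x hx hx'
    exact ((L.hasFDerivAt.comp_hasDerivAt x (hx hx')).deriv).symm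
  exact Complex.ext (key Complex.reCLM) (key Complex.imCLM)

end AbsolutelyContinuous

/-! ### Plane waves and integration by parts -/

lemma memLp_of_continuousOn {f : ℝ → ℂ} (hf : ContinuousOn f (Set.Icc 0 1)) (q : ENNReal) :
    MemLp f q unitMeasure := by
  obtain ⟨M, hM⟩ := isCompact_Icc.exists_bound_of_continuousOn hf
  refine MemLp.of_bound (hf.aestronglyMeasurable measurableSet_Icc) M ?_
  filter_upwards [ae_restrict_mem measurableSet_Icc] with x hx using hM x hx

lemma intervalIntegrable_of_integrable {f : ℝ → ℂ} (hf : Integrable f unitMeasure) :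
    IntervalIntegrable f volume 0 1 := by
  rw [intervalIntegrable_iff_integrableOn_Icc_of_le zero_le_one]
  exact hf

/-- The plane wave `x ↦ exp(-iωx)`. -/
def wave (w : ℝ) (x : ℝ) : ℂ := Complex.exp (-(Complex.I * w * x))

lemma hasDerivAt_wave (w x : ℝ) : HasDerivAt (wave w) (-(Complex.I * w) * wave w x) x := by
  have h : HasDerivAt (fun x : ℝ => -(Complex.I * w * (x : ℂ))) (-(Complex.I * w)) x := by
    simpa using! ((Complex.ofRealCLM.hasDerivAt (x := x)).const_mul (Complex.I * w)).neg
  rw [mul_comm]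
  exact h.cexp

lemma contDiff_wave (w : ℝ) : ContDiff ℝ 1 (wave w) := by
  have h : ContDiff ℝ 1 (fun x : ℝ => (x : ℂ)) := Complex.ofRealCLM.contDiff
  exact (contDiff_const.mul h).neg.cexp

lemma norm_wave (w x : ℝ) : ‖wave w x‖ = 1 := by
  rw [wave, show -(Complex.I * w * x) = ((-(w * x) : ℝ) : ℂ) * Complex.I by push_cast; ring,
    Complex.norm_exp_ofReal_mul_I]

lemma memLp_mul_wave {f : ℝ → ℂ} {q : ENNReal} (hf : MemLp f q unitMeasure) (w : ℝ) :
    MemLp (fun x => f x * wave w x) q unitMeasure :=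
  hf.of_le (hf.1.mul (contDiff_wave w).continuous.aestronglyMeasurable)
    (Filter.Eventually.of_forall fun x => by simp [norm_wave])

lemma integrable_mul_mul_wave {u v : ℝ → ℂ} (hu : MemLp u 2 unitMeasure)
    (hv : MemLp v 2 unitMeasure) (w : ℝ) :
    Integrable (fun x => u x * v x * wave w x) unitMeasure := by
  have := hu.integrable_mul (memLp_mul_wave hv w)
  simpa [mul_assoc, Pi.mul_def] using this

lemma l2norm_nonneg (f : ℝ → ℂ) : 0 ≤ l2norm f := ENNReal.toReal_nonneg

/-- The Cauchy-Schwarz inequality. -/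
lemma norm_integral_mul_mul_wave_le {u v : ℝ → ℂ} (hu : MemLp u 2 unitMeasure)
    (hv : MemLp v 2 unitMeasure) (w : ℝ) :
    ‖∫ x in (0 : ℝ)..1, u x * v x * wave w x‖ ≤ l2norm u * l2norm v := by
  rw [intervalIntegral.integral_of_le zero_le_one, ← integral_Icc_eq_integral_Ioc]
  refine (norm_integral_le_integral_norm _).trans ?_
  simp only [norm_mul, norm_wave, mul_one]
  have h := eLpNorm_smul_le_mul_eLpNorm hv.1 hu.1 (p := 2) (q := 2) (r := 1)
  rw [l2norm, l2norm, ← ENNReal.toReal_mul]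
  have h2 := ENNReal.toReal_mono (ENNReal.mul_ne_top hu.eLpNorm_ne_top hv.eLpNorm_ne_top) h
  refine le_trans (le_of_eq ?_) h2
  rw [toReal_eLpNorm (hu.1.smul hv.1), lpNorm_one_eq_integral_norm (hu.1.smul hv.1)]
  simp

/-- Integration by parts on a period for the product of two absolutely continuous functions and a
plane wave with matching boundary values. -/
lemma integral_by_parts_wave {u u' v v' : ℝ → ℂ} {w : ℝ}
    (hu : AbsolutelyContinuousOnInterval u 0 1) (hv : AbsolutelyContinuousOnInterval v 0 1)
    (hu' : MemLp u' 2 unitMeasure) (hv' : MemLp v' 2 unitMeasure)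
    (hdu : ∀ᵐ x ∂unitMeasure, HasDerivAt u (u' x) x)
    (hdv : ∀ᵐ x ∂unitMeasure, HasDerivAt v (v' x) x)
    (hb : u 1 * v 1 * wave w 1 = u 0 * v 0 * wave w 0) :
    ∫ x in (0 : ℝ)..1, u x * v' x * wave w x =
      Complex.I * w * (∫ x in (0 : ℝ)..1, u x * v x * wave w x)
        - ∫ x in (0 : ℝ)..1, u' x * v x * wave w x := by
  have hcu : MemLp u 2 unitMeasure := memLp_of_continuousOn (by simpa using hu.continuousOn) _
  have hcv : MemLp v 2 unitMeasure := memLp_of_continuousOn (by simpa using hv.continuousOn) _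
  have i₁ := intervalIntegrable_of_integrable (integrable_mul_mul_wave hcu hv' w)
  have i₂ := intervalIntegrable_of_integrable (integrable_mul_mul_wave hu' hcv w)
  have i₃ := intervalIntegrable_of_integrable (integrable_mul_mul_wave hcu hcv w)
  have hac : AbsolutelyContinuousOnInterval (fun x => u x * v x * wave w x) 0 1 :=
    (hu.smul hv).smul (contDiff_wave w).contDiffOn.absolutelyContinuousOnInterval
  have h := integral_eq_sub_of_absolutelyContinuousOnInterval hac
    ((i₁.add i₂).sub (i₃.const_mul (Complex.I * w))) ?_
  · rw [hb, sub_self, intervalIntegral.integral_sub (i₁.add i₂) (i₃.const_mul _),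
      intervalIntegral.integral_add i₁ i₂, intervalIntegral.integral_const_mul] at h
    linear_combination h
  · rw [ae_restrict_iff' measurableSet_Icc] at hdu hdv
    filter_upwards [hdu, hdv] with x h₁ h₂ hx
    rw [Set.uIoc_of_le zero_le_one] at hx
    have hx' := Set.Ioc_subset_Icc_self hx
    convert! ((h₁ hx').mul (h₂ hx')).mul (hasDerivAt_wave w x) using 1
    simp only [Pi.mul_apply]
    ring

/-! ### Coefficients, domain functions and their Fourier coefficients -/

section Coefficient

variable {m : ℕ} {f : ℝ → ℂ}

lemma IsCoefficient.iteratedDeriv_one (hf : IsCoefficient m f) (s : ℕ) :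
    iteratedDeriv s f 1 = iteratedDeriv s f 0 := by
  have h := iteratedDeriv_comp_add_const s f 1
  rw [show (fun z => f (z + 1)) = f from funext hf.periodic] at h
  simpa using (congrFun h 0).symm

lemma IsCoefficient.memLp_iteratedDeriv (hf : IsCoefficient m f) {s : ℕ} (hs : s ≤ m) :
    MemLp (iteratedDeriv s f) 2 unitMeasure := by
  rcases hs.lt_or_eq with h | rfl
  · exact memLp_of_continuousOn (by simpa using (hf.absCont s h 0 1).continuousOn) _
  · exact hf.memLp

lemma IsCoefficient.ae_hasDerivAt (hf : IsCoefficient m f) {s : ℕ} (hs : s < m) :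
    ∀ᵐ x ∂unitMeasure, HasDerivAt (iteratedDeriv s f) (iteratedDeriv (s + 1) f x) x := by
  rw [ae_restrict_iff' measurableSet_Icc]
  filter_upwards [ae_differentiableAt_of_absolutelyContinuousOnInterval (hf.absCont s hs 0 1)]
    with x h hx
  rw [iteratedDeriv_succ]
  exact (h (by simpa using hx)).hasDerivAt

end Coefficient

section Domain

variable {n : ℕ} {t : ℝ} {y : ℝ → ℂ}

lemma der_zero (y : ℝ → ℂ) : der 0 y = y := by
  funext x
  simp [der]

lemma InDomain.memLp_der (hy : InDomain n t y) {j : ℕ} (hj : j ≤ n) :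
    MemLp (der j y) 2 unitMeasure := by
  rcases hj.lt_or_eq with h | rfl
  · exact memLp_of_continuousOn (by simpa using (hy.absCont j h).continuousOn) _
  · exact hy.memLp

lemma InDomain.ae_hasDerivAt (hy : InDomain n t y) {j : ℕ} (hj : j < n) :
    ∀ᵐ x ∂unitMeasure, HasDerivAt (der j y) (der (j + 1) y x) x := by
  -- The end points, where `der` is one-sided, form a null set.
  rw [unitMeasure, ← Measure.restrict_congr_set Ioo_ae_eq_Icc, ae_restrict_iff' measurableSet_Ioo]
  filter_upwards [ae_differentiableAt_of_absolutelyContinuousOnInterval (hy.absCont j hj)]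
    with x h hx
  rw [der.eq_1 (j + 1), iteratedDerivWithin_succ, derivWithin_of_mem_nhds (Icc_mem_nhds hx.1 hx.2)]
  exact (h (by simpa using Set.Ioo_subset_Icc_self hx)).hasDerivAt

/-- The frequency of the eigenfunction of the free operator with index `k`. -/
def freq (t : ℝ) (k : ℤ) : ℝ := Real.pi * (2 * k + t)

lemma wave_zero (w : ℝ) : wave w 0 = 1 := by simp [wave]

lemma exp_mul_wave_freq_one (t : ℝ) (k : ℤ) :
    Complex.exp (Complex.I * Real.pi * t) * wave (freq t k) 1 = 1 := by
  rw [wave, ← Complex.exp_add, Complex.exp_eq_one_iff]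
  refine ⟨-k, ?_⟩
  simp only [freq]
  push_cast
  ring

lemma InDomain.der_mul_wave_one (hy : InDomain n t y) {j : ℕ} (hj : j < n) (k : ℤ) :
    der j y 1 * wave (freq t k) 1 = der j y 0 := by
  rw [hy.boundary j hj, mul_right_comm, exp_mul_wave_freq_one, one_mul]

/-- The Fourier coefficient of `y` with index `k`. -/
def coeff (t : ℝ) (y : ℝ → ℂ) (k : ℤ) : ℂ := ∫ x in (0 : ℝ)..1, y x * wave (freq t k) x

lemma InDomain.integral_der_mul_wave (hy : InDomain n t y) (k : ℤ) {j : ℕ} (hj : j ≤ n) :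
    ∫ x in (0 : ℝ)..1, der j y x * wave (freq t k) x =
      (Complex.I * freq t k) ^ j * coeff t y k := by
  induction j with
  | zero =>
    rw [pow_zero, one_mul, coeff]
    exact intervalIntegral.integral_congr fun x _ => by simp [der]
  | succ j ih =>
    have h := integral_by_parts_wave (u := fun _ => 1) (u' := fun _ => 0) (w := freq t k)
      contDiffOn_const.absolutelyContinuousOnInterval (hy.absCont j hj) (memLp_const 0)
      (hy.memLp_der hj) (Filter.Eventually.of_forall fun x => hasDerivAt_const x 1)
      (hy.ae_hasDerivAt hj)
      (by rw [one_mul, one_mul, hy.der_mul_wave_one hj, wave_zero, mul_one])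
    simp only [one_mul, zero_mul, intervalIntegral.integral_zero, sub_zero] at h
    rw [h, ih (Nat.le_of_succ_le hj), pow_succ']
    ring

variable {m : ℕ} {f : ℝ → ℂ}

lemma InDomain.integral_mul_der_succ_mul_wave (hy : InDomain n t y) (hf : IsCoefficient m f)
    (k : ℤ) {s j : ℕ} (hs : s < m) (hj : j < n) :
    ∫ x in (0 : ℝ)..1, iteratedDeriv s f x * der (j + 1) y x * wave (freq t k) x =
      Complex.I * freq t k *
          (∫ x in (0 : ℝ)..1, iteratedDeriv s f x * der j y x * wave (freq t k) x)
        - ∫ x in (0 : ℝ)..1, iteratedDeriv (s + 1) f x * der j y x * wave (freq t k) x :=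
  integral_by_parts_wave (hf.absCont s hs 0 1) (hy.absCont j hj) (hf.memLp_iteratedDeriv hs)
    (hy.memLp_der hj) (hf.ae_hasDerivAt hs) (hy.ae_hasDerivAt hj)
    (by rw [mul_assoc, hy.der_mul_wave_one hj, hf.iteratedDeriv_one, wave_zero, mul_one])

/-- Each integration by parts either yields a factor `iω_k` or differentiates the coefficient once
more; by Pascal's rule the two choices accumulate to binomial coefficients. The induction must allow
any starting order `s`, since the second choice raises it. -/
lemma InDomain.norm_integral_mul_der_mul_wave_le (hy : InDomain n t y) (hf : IsCoefficient m f)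
    (k : ℤ) (j : ℕ) (hj : j ≤ n) (s : ℕ) (hs : s + j ≤ m) :
    ‖∫ x in (0 : ℝ)..1, iteratedDeriv s f x * der j y x * wave (freq t k) x‖ ≤
      (∑ i ∈ Finset.range (j + 1), (j.choose i : ℝ) *
        (l2norm (iteratedDeriv (s + i) f) * |freq t k| ^ (j - i))) * l2norm y := by
  induction j generalizing s with
  | zero =>
    have h := norm_integral_mul_mul_wave_le (hf.memLp_iteratedDeriv (s := s) (by omega))
      (hy.memLp_der (Nat.zero_le n)) (freq t k)
    rw [der_zero] at h
    simpa [der_zero] using h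
  | succ j ih =>
    rw [hy.integral_mul_der_succ_mul_wave hf k (by omega) (by omega)]
    refine (norm_sub_le _ _).trans ?_
    rw [norm_mul]
    have h₁ := ih (by omega) s (by omega)
    have h₂ := ih (by omega) (s + 1) (by omega)
    have h₃ : ‖Complex.I * (freq t k : ℂ)‖ = |freq t k| := by simp
    rw [h₃, Finset.sum_choose_succ_mul
      (fun i l => l2norm (iteratedDeriv (s + i) f) * |freq t k| ^ l), add_mul]
    refine add_le_add ((mul_le_mul_of_nonneg_left h₁ (abs_nonneg _)).trans (le_of_eq ?_))
      (h₂.trans (le_of_eq ?_))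
    · rw [← mul_assoc, Finset.mul_sum]
      congr 1
      refine Finset.sum_congr rfl fun i hi => ?_
      rw [Nat.succ_sub (Finset.mem_range_succ_iff.mp hi), pow_succ]
      ring
    · congr 1
      refine Finset.sum_congr rfl fun i _ => ?_
      rw [add_right_comm, add_assoc]

end Domain

/-! ### The bound on the Fourier coefficients of an eigenfunction -/

/-- The growth factor of the perturbation at the index `k`. -/
def weight (n : ℕ) (t : ℝ) (k : ℤ) : ℝ := if k = 0 then 1 else |2 * (k : ℝ) + t| ^ (n - 2)

lemma one_le_abs_two_mul_add {t : ℝ} (ht : |t| ≤ 1) {k : ℤ} (hk : k ≠ 0) :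
    1 ≤ |2 * (k : ℝ) + t| := by
  have h : (1 : ℝ) ≤ |(k : ℝ)| := by exact_mod_cast Int.one_le_abs hk
  have h2 := abs_sub_abs_le_abs_sub (2 * (k : ℝ)) (-t)
  rw [abs_neg, sub_neg_eq_add, abs_mul, abs_two] at h2
  linarith

/-- Lower powers are dominated by the top one only when the base is at least 1; at `k = 0` the base
is `|t| ≤ 1`, hence the value 1 of `weight` there. -/
lemma abs_pow_le_weight {n l : ℕ} {t : ℝ} (ht : |t| ≤ 1) (hl : l ≤ n - 2) (k : ℤ) :
    |2 * (k : ℝ) + t| ^ l ≤ weight n t k := by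
  unfold weight
  split_ifs with h
  · subst h
    simpa using pow_le_one₀ (abs_nonneg t) ht
  · exact pow_le_pow_right₀ (one_le_abs_two_mul_add ht h) hl

lemma constC_nonneg (n : ℕ) (p : ℕ → ℝ → ℂ) : 0 ≤ constC n p := by
  unfold constC
  refine Finset.sum_nonneg fun v _ => Finset.sum_nonneg fun s _ => ?_
  have := l2norm_nonneg (iteratedDeriv s (p v))
  positivity

lemma sum_choose_mul_le_constC {n : ℕ} (p : ℕ → ℝ → ℂ) {t : ℝ} (ht : |t| ≤ 1)
    (k : ℤ) :
    ∑ v ∈ Finset.Icc 2 n, ∑ i ∈ Finset.range (n - v + 1), ((n - v).choose i : ℝ) *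
        (l2norm (iteratedDeriv i (p v)) * |freq t k| ^ (n - v - i)) ≤
      Real.pi ^ (n - 2) * weight n t k * constC n p := by
  rw [constC, Finset.mul_sum]
  refine Finset.sum_le_sum fun v hv => ?_
  rw [Finset.mul_sum]
  refine Finset.sum_le_sum fun i hi => ?_
  rw [Finset.mem_Icc] at hv
  rw [Finset.mem_range_succ_iff] at hi
  have hpi := Real.pi_pos
  -- The surplus power of `π` is the denominator in `constC`.
  have e : Real.pi ^ (n - 2) = Real.pi ^ (n - v - i) * Real.pi ^ (v + i - 2) := by
    rw [← pow_add]
    congr 1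
    omega
  have hw := abs_pow_le_weight (n := n) (l := n - v - i) ht (by omega) k
  have hl := l2norm_nonneg (iteratedDeriv i (p v))
  rw [freq, abs_mul, abs_of_pos hpi, mul_pow, e, Nat.cast_choose ℝ hi]
  calc _ = ((n - v).factorial * l2norm (iteratedDeriv i (p v)) * Real.pi ^ (n - v - i)) /
        (i.factorial * (n - v - i).factorial) * |2 * (k : ℝ) + t| ^ (n - v - i) := by
        field_simp
    _ ≤ ((n - v).factorial * l2norm (iteratedDeriv i (p v)) * Real.pi ^ (n - v - i)) /
        (i.factorial * (n - v - i).factorial) * weight n t k := by gcongr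
    _ = _ := by field_simp

/-- Away from the free eigenvalues the Fourier coefficients of an eigenfunction are small. -/
lemma InDomain.norm_sub_mul_norm_coeff_le {n : ℕ} {t ε : ℝ} {lam : ℂ} {y : ℝ → ℂ}
    {p : ℕ → ℝ → ℂ} (ht : |t| ≤ 1) (hε : ε ∈ Set.Icc (0 : ℝ) 1)
    (hp : ∀ v ∈ Finset.Icc 2 n, IsCoefficient (n - v) (p v)) (hy : InDomain n t y)
    (he : homotopyExpr n p ε y =ᵐ[unitMeasure] fun x => lam * y x) (k : ℤ) :
    ‖lam - ((freq t k ^ n : ℝ) : ℂ)‖ * ‖coeff t y k‖ ≤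
      Real.pi ^ (n - 2) * weight n t k * constC n p * l2norm y := by
  set w := freq t k with hw
  have hint : ∀ v ∈ Finset.Icc 2 n, IntervalIntegrable
      (fun x => p v x * der (n - v) y x * wave w x) volume 0 1 := fun v hv => by
    have h := integrable_mul_mul_wave ((hp v hv).memLp_iteratedDeriv (Nat.zero_le _))
      (hy.memLp_der (Nat.sub_le n v)) w
    rw [iteratedDeriv_zero] at h
    exact intervalIntegrable_of_integrable h
  have hint0 : IntervalIntegrable (fun x => der n y x * wave w x) volume 0 1 :=
    intervalIntegrable_of_integrable ((memLp_mul_wave (hy.memLp_der le_rfl) w).integrable one_le_two)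
  have e₁ : ∫ x in (0 : ℝ)..1, homotopyExpr n p ε y x * wave w x = lam * coeff t y k := by
    rw [coeff, ← intervalIntegral.integral_const_mul]
    apply intervalIntegral.integral_congr_ae
    rw [Filter.EventuallyEq, ae_restrict_iff' measurableSet_Icc] at he
    filter_upwards [he] with x hx hx'
    rw [hx (by rw [Set.uIoc_of_le zero_le_one] at hx'; exact Set.Ioc_subset_Icc_self hx')]
    ring
  have e₂ : ∫ x in (0 : ℝ)..1, homotopyExpr n p ε y x * wave w x =
      (w : ℂ) ^ n * coeff t y k + ε * ∑ v ∈ Finset.Icc 2 n, (-Complex.I) ^ (n - v) *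
        ∫ x in (0 : ℝ)..1, p v x * der (n - v) y x * wave w x := by
    have e₃ : ∀ x, homotopyExpr n p ε y x * wave w x = (-Complex.I) ^ n * (der n y x * wave w x) +
        ε * ∑ v ∈ Finset.Icc 2 n, (-Complex.I) ^ (n - v) *
          (p v x * der (n - v) y x * wave w x) := by
      intro x
      simp only [homotopyExpr, diffExpr, Pi.zero_apply, mul_zero, zero_mul, Finset.sum_const_zero,
        add_zero, add_sub_cancel_left, add_mul]
      rw [mul_assoc, mul_assoc, Finset.sum_mul]
      simp only [mul_assoc]
    simp only [e₃]
    have hint1 : IntervalIntegrable (fun x => ∑ v ∈ Finset.Icc 2 n, (-Complex.I) ^ (n - v) *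
        (p v x * der (n - v) y x * wave w x)) volume 0 1 := by
      simpa only [Finset.sum_fn] using
        IntervalIntegrable.sum _ fun v hv => (hint v hv).const_mul ((-Complex.I) ^ (n - v))
    rw [intervalIntegral.integral_add (hint0.const_mul _) (hint1.const_mul _),
      intervalIntegral.integral_const_mul, intervalIntegral.integral_const_mul,
      hy.integral_der_mul_wave k le_rfl,
      intervalIntegral.integral_finsetSum fun v hv => (hint v hv).const_mul _]
    simp only [intervalIntegral.integral_const_mul]
    rw [← mul_assoc, ← mul_pow, ← hw, ← mul_assoc, neg_mul, Complex.I_mul_I, neg_neg, one_mul]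
  have e₄ : (lam - ((w ^ n : ℝ) : ℂ)) * coeff t y k =
      ε * ∑ v ∈ Finset.Icc 2 n, (-Complex.I) ^ (n - v) *
        ∫ x in (0 : ℝ)..1, p v x * der (n - v) y x * wave w x := by
    push_cast
    linear_combination e₂ - e₁
  rw [← norm_mul, e₄, norm_mul, Complex.norm_real, Real.norm_of_nonneg hε.1]
  refine (mul_le_of_le_one_left (norm_nonneg _) hε.2).trans ?_
  refine (norm_sum_le _ _).trans ?_
  refine le_trans ?_ (mul_le_mul_of_nonneg_right (sum_choose_mul_le_constC p ht k)
    (l2norm_nonneg y))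
  rw [Finset.sum_mul]
  refine Finset.sum_le_sum fun v hv => ?_
  rw [norm_mul, norm_pow, norm_neg, Complex.norm_I, one_pow, one_mul]
  have h := hy.norm_integral_mul_der_mul_wave_le (hp v hv) k (n - v) (Nat.sub_le n v) 0 (by omega)
  simpa only [iteratedDeriv_zero, zero_add] using h

/-! ### Parseval's identity -/

lemma l2norm_sq {y : ℝ → ℂ} (hy : MemLp y 2 unitMeasure) :
    l2norm y ^ 2 = ∫ x in (0 : ℝ)..1, ‖y x‖ ^ 2 := by
  rw [intervalIntegral.integral_of_le zero_le_one, ← integral_Icc_eq_integral_Ioc, l2norm,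
    hy.eLpNorm_eq_integral_rpow_norm (by norm_num) (by norm_num)]
  have h : 0 ≤ ∫ x in Set.Icc (0 : ℝ) 1, ‖y x‖ ^ 2 := integral_nonneg fun x => by positivity
  simp only [ENNReal.toReal_ofNat, Real.rpow_two]
  rw [ENNReal.toReal_ofReal (by positivity), ← Real.rpow_natCast, ← Real.rpow_mul h]
  norm_num

/-- Parseval's identity. -/
lemma hasSum_sq_coeff {y : ℝ → ℂ} (hy : MemLp y 2 unitMeasure) (t : ℝ) :
    HasSum (fun k => ‖coeff t y k‖ ^ 2) (l2norm y ^ 2) := by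
  -- Removing the phase `e^{iπtx}` turns the coefficients into ordinary Fourier coefficients.
  have hm : MemLp (fun x => y x * wave (Real.pi * t) x) 2 (volume.restrict (Set.Ioc 0 1)) := by
    rw [Measure.restrict_congr_set Ioc_ae_eq_Icc]
    exact memLp_mul_wave hy _
  have h := hasSum_sq_fourierCoeffOn zero_lt_one hm
  rw [l2norm_sq hy]
  convert! h using 1
  · funext k
    rw [fourierCoeffOn_eq_integral, coeff]
    simp only [sub_zero, div_one, one_smul, smul_eq_mul]
    congr 2
    refine intervalIntegral.integral_congr fun x _ => ?_
    rw [fourier_coe_apply, mul_left_comm, wave, wave, ← Complex.exp_add, freq]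
    congr 2
    push_cast
    ring
  · simp [norm_wave]

lemma l2norm_pos {y : ℝ → ℂ} (hy : MemLp y 2 unitMeasure) (h : ¬ y =ᵐ[unitMeasure] 0) :
    0 < l2norm y := by
  refine ENNReal.toReal_pos (fun h0 => h ?_) hy.eLpNorm_ne_top
  exact (eLpNorm_eq_zero_iff hy.1 (by norm_num)).1 h0

/-! ### Separation of the disks -/

section Separation

variable {n : ℕ}

/-- A bound for the radius of the disk with index `k`, in units of `π ^ n`. -/
def scaledRadius (n : ℕ) (t : ℝ) (k : ℤ) : ℝ :=
  if k = 0 then 1 / 5 else 3 / 10 * |2 * (k : ℝ) + t| ^ (n - 2)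

lemma scaledRadius_neg (n : ℕ) (t : ℝ) (k : ℤ) :
    scaledRadius n (-t) (-k) = scaledRadius n t k := by
  have : 2 * ((-k : ℤ) : ℝ) + -t = -(2 * (k : ℝ) + t) := by push_cast; ring
  simp only [scaledRadius, this, abs_neg, neg_eq_zero]

lemma weight_neg (n : ℕ) (t : ℝ) (k : ℤ) : weight n (-t) (-k) = weight n t k := by
  have : 2 * ((-k : ℤ) : ℝ) + -t = -(2 * (k : ℝ) + t) := by push_cast; ring
  simp only [weight, this, abs_neg, neg_eq_zero]

lemma neg_two_mul_add_pow (hn : Odd n) (t : ℝ) (k : ℤ) :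
    (2 * ((-k : ℤ) : ℝ) + -t) ^ n = -(2 * (k : ℝ) + t) ^ n := by
  rw [show 2 * ((-k : ℤ) : ℝ) + -t = -(2 * (k : ℝ) + t) by push_cast; ring, hn.neg_pow]

lemma pow_add_scaledRadius_lt_of_nonneg (hn : Odd n) (h3 : 3 ≤ n) {t : ℝ} (ht : |t| ≤ 1) {j k : ℤ}
    (hj : 0 ≤ j) (hjk : j < k) :
    (2 * (j : ℝ) + t) ^ n + scaledRadius n t j < (2 * (k : ℝ) + t) ^ n - scaledRadius n t k := by
  obtain ⟨ht₁, ht₂⟩ := abs_le.mp ht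
  have hk0 : k ≠ 0 := by omega
  have hjk' : (j : ℝ) + 1 ≤ k := by exact_mod_cast hjk
  have hj' : (0 : ℝ) ≤ j := by exact_mod_cast hj
  have hb : 1 ≤ 2 * (k : ℝ) + t := by linarith
  have hsplit : ∀ x : ℝ, x ^ n = x ^ (n - 2) * x ^ 2 := fun x => by
    rw [← pow_add]
    congr 1
    omega
  rw [scaledRadius, scaledRadius, if_neg hk0, abs_of_pos (by linarith : 0 < 2 * (k : ℝ) + t)]
  set b := 2 * (k : ℝ) + t with hbd
  have hbp : 1 ≤ b ^ (n - 2) := one_le_pow₀ hb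
  rw [hsplit b]
  split_ifs with h
  · subst h
    rw [Int.cast_zero, mul_zero, zero_add]
    rcases le_or_gt t 0 with h0 | h0
    -- For `t ≤ 0` the central centre is nonpositive and `b ≥ 1` suffices; for `t > 0` it may reach
    -- 1, but then `b ≥ 2`.
    · have h1 := hn.pow_nonpos h0
      have h2 : 1 ≤ b ^ (n - 2) * b ^ 2 := hsplit b ▸ one_le_pow₀ hb
      have h3 : b ^ (n - 2) ≤ b ^ (n - 2) * b ^ 2 := le_mul_of_one_le_right (by positivity)
        (one_le_pow₀ hb)
      linarith
    · have h1 : t ^ n ≤ 1 := pow_le_one₀ h0.le ht₂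
      have h2 : 2 ≤ b := by linarith
      have h3 : b ^ (n - 2) * 4 ≤ b ^ (n - 2) * b ^ 2 := by gcongr; nlinarith
      linarith
  · have hj1 : (1 : ℝ) ≤ j := by exact_mod_cast (by omega : 1 ≤ j)
    have ha : 1 ≤ 2 * (j : ℝ) + t := by linarith
    rw [abs_of_pos (by linarith : 0 < 2 * (j : ℝ) + t), hsplit (2 * (j : ℝ) + t)]
    have hab : 2 * (j : ℝ) + t + 2 ≤ b := by linarith
    set a := 2 * (j : ℝ) + t
    have hp : a ^ (n - 2) ≤ b ^ (n - 2) := pow_le_pow_left₀ (by linarith) (by linarith) _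
    have hap : 0 < a ^ (n - 2) := by positivity
    have hq : a ^ 2 + 3 / 10 < b ^ 2 - 3 / 10 := by nlinarith
    calc a ^ (n - 2) * a ^ 2 + 3 / 10 * a ^ (n - 2) = a ^ (n - 2) * (a ^ 2 + 3 / 10) := by ring
      _ < a ^ (n - 2) * (b ^ 2 - 3 / 10) := by gcongr
      _ ≤ b ^ (n - 2) * (b ^ 2 - 3 / 10) := by gcongr; nlinarith
      _ = _ := by ring

lemma scaledRadius_nonneg (n : ℕ) (t : ℝ) (k : ℤ) : 0 ≤ scaledRadius n t k := by
  unfold scaledRadius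
  split_ifs <;> positivity

/-- As `n` is odd, `(j, k, t) ↦ (-k, -j, -t)` reflects the configuration, which settles nonpositive
indices; indices of opposite sign are compared through index 0. -/
lemma pow_add_scaledRadius_lt (hn : Odd n) (h3 : 3 ≤ n) {t : ℝ} (ht : |t| ≤ 1) {j k : ℤ}
    (hjk : j < k) :
    (2 * (j : ℝ) + t) ^ n + scaledRadius n t j < (2 * (k : ℝ) + t) ^ n - scaledRadius n t k := by
  rcases le_or_gt 0 j with hj | hj
  · exact pow_add_scaledRadius_lt_of_nonneg hn h3 ht hj hjk
  have key : ∀ {i l : ℤ}, i < l → l ≤ 0 →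
      (2 * (i : ℝ) + t) ^ n + scaledRadius n t i < (2 * (l : ℝ) + t) ^ n - scaledRadius n t l := by
    intro i l hil hl
    have h := pow_add_scaledRadius_lt_of_nonneg hn h3 (t := -t) (by rwa [abs_neg])
      (j := -l) (k := -i) (by omega) (by omega)
    rw [neg_two_mul_add_pow hn, neg_two_mul_add_pow hn, scaledRadius_neg, scaledRadius_neg] at h
    linarith
  rcases le_or_gt k 0 with hk | hk
  · exact key hjk hk
  · have h₁ := key hj le_rfl
    have h₂ := pow_add_scaledRadius_lt_of_nonneg hn h3 ht le_rfl hk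
    have := scaledRadius_nonneg n t 0
    linarith

end Separation

/-! ### The sum of squares is less than one -/

section Sum

/-- A summable majorant supported on `|k| ≥ 2`. -/
def tail (k : ℤ) : ℝ := if 2 ≤ |k| then 1 / (2 * |(k : ℝ)| - 1) ^ 2 else 0

lemma tail_nonneg (k : ℤ) : 0 ≤ tail k := by
  unfold tail
  split_ifs <;> positivity

lemma tail_neg (k : ℤ) : tail (-k) = tail k := by simp [tail]

/-- Telescoping majorant, from `(2m+3)² ≥ 4(m+1)(m+2)`. -/
lemma tail_natCast_add_two_le (m : ℕ) :
    tail ((m + 2 : ℕ) : ℤ) ≤ 1 / (4 * (m + 1 : ℝ)) - 1 / (4 * (m + 1 + 1 : ℝ)) := by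
  have h : (2 : ℤ) ≤ |((m + 2 : ℕ) : ℤ)| := by
    rw [abs_of_nonneg (by positivity)]
    push_cast
    omega
  rw [tail, if_pos h, Int.cast_natCast, abs_of_nonneg (by positivity)]
  push_cast
  have e : (1 : ℝ) / (4 * (m + 1)) - 1 / (4 * (m + 1 + 1)) = 1 / (4 * (m + 1) * (m + 2)) := by
    field_simp
    ring
  rw [e]
  apply one_div_le_one_div_of_le (by positivity)
  nlinarith

lemma sum_tail_natCast_le (N : ℕ) :
    ∑ m ∈ Finset.range (N + 2), tail (m : ℤ) ≤ 1 / 4 - 1 / (4 * (N + 1 : ℝ)) := by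
  induction N with
  | zero => simp [Finset.sum_range_succ, tail]
  | succ N ih =>
    rw [show N + 1 + 2 = (N + 2) + 1 by ring, Finset.sum_range_succ]
    have := tail_natCast_add_two_le N
    push_cast at this ⊢
    linarith

lemma sum_range_tail_natCast_le (N : ℕ) : ∑ m ∈ Finset.range N, tail (m : ℤ) ≤ 1 / 4 := by
  have h := sum_tail_natCast_le N
  have h2 : ∑ m ∈ Finset.range N, tail (m : ℤ) ≤ ∑ m ∈ Finset.range (N + 2), tail (m : ℤ) :=
    Finset.sum_le_sum_of_subset_of_nonneg (Finset.range_mono (by omega))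
      fun _ _ _ => tail_nonneg _
  have h3 : 0 ≤ 1 / (4 * (N + 1 : ℝ)) := by positivity
  linarith

lemma sum_range_tail_neg_le (N : ℕ) :
    ∑ m ∈ Finset.range N, tail (-((m : ℤ) + 1)) ≤ 1 / 4 := by
  have h := sum_range_tail_natCast_le (N + 1)
  rw [Finset.sum_range_succ'] at h
  have h0 := tail_nonneg ((0 : ℕ) : ℤ)
  simp only [tail_neg]
  push_cast at h h0
  linarith

lemma exists_hasSum_tail : ∃ S ≤ (1 : ℝ) / 2, HasSum tail S := by
  have h₁ := summable_of_sum_range_le (fun _ => tail_nonneg _) sum_range_tail_natCast_le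
  have h₂ := summable_of_sum_range_le (fun _ => tail_nonneg _) sum_range_tail_neg_le
  refine ⟨_, ?_, h₁.hasSum.of_nat_of_neg_add_one h₂.hasSum⟩
  have h₃ := Real.tsum_le_of_sum_range_le (fun _ => tail_nonneg _) sum_range_tail_natCast_le
  have h₄ := Real.tsum_le_of_sum_range_le (fun _ => tail_nonneg _) sum_range_tail_neg_le
  linarith

lemma weight_pos {n : ℕ} {t : ℝ} (ht : |t| ≤ 1) (k : ℤ) : 0 < weight n t k := by
  unfold weight
  split_ifs with h
  · exact one_pos
  · have := one_le_abs_two_mul_add ht h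
    positivity

/-- A majorant with sum less than one for the squares of `c * weight n t k / D k`. -/
lemma exists_majorant_of_nonneg {n : ℕ} (hn : Odd n) (h3 : 3 ≤ n) {t c x : ℝ} (ht : |t| ≤ 1)
    (hc : c ^ 2 ≤ 1 / 32) (hc0 : 0 ≤ c) (hx : 0 ≤ x) {D : ℤ → ℝ}
    (hD : ∀ k : ℤ, |x - (2 * (k : ℝ) + t) ^ n| ≤ D k) (h0 : 1 / 5 ≤ D 0)
    (h1 : 3 / 10 * weight n t 1 ≤ D 1)
    (h2 : ∀ k : ℤ, 2 ≤ |k| → 3 / 2 * c * weight n t k ≤ D k) :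
    ∃ (g : ℤ → ℝ) (S : ℝ), HasSum g S ∧ S < 1 ∧
      ∀ k, (c * weight n t k) ^ 2 ≤ g k * D k ^ 2 := by
  obtain ⟨ht₁, ht₂⟩ := abs_le.mp ht
  obtain ⟨T, hT, hTs⟩ := exists_hasSum_tail
  have hT0 : 0 ≤ T := hTs.nonneg tail_nonneg
  have hsplit : ∀ x : ℝ, x ^ n = x ^ (n - 2) * x ^ 2 := fun x => by
    rw [← pow_add]
    congr 1
    omega
  -- Here `u` is a lower bound for `D k / weight n t k`, so the term is at most `c²/u²`.
  have helper : ∀ {k : ℤ} {u g : ℝ}, 0 ≤ g → 0 ≤ u → weight n t k * u ≤ D k → c ^ 2 ≤ g * u ^ 2 →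
      (c * weight n t k) ^ 2 ≤ g * D k ^ 2 := by
    intro k u g hg hu hW hcg
    have hw := weight_pos (n := n) ht k
    calc (c * weight n t k) ^ 2 = c ^ 2 * weight n t k ^ 2 := by ring
      _ ≤ g * u ^ 2 * weight n t k ^ 2 := by gcongr
      _ = g * (weight n t k * u) ^ 2 := by ring
      _ ≤ g * D k ^ 2 := by gcongr
  have hweight : ∀ {k : ℤ}, k ≠ 0 → weight n t k = |2 * (k : ℝ) + t| ^ (n - 2) :=
    fun hk => if_neg hk
  -- Since `x ≥ 0`, negative centres are at least their own modulus away, so `u = |2k+t|²`.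
  have hneg : ∀ {k : ℤ}, k < 0 → weight n t k * |2 * (k : ℝ) + t| ^ 2 ≤ D k := by
    intro k hk
    have hk' : (k : ℝ) + 1 ≤ 0 := by exact_mod_cast hk
    have ha : 2 * (k : ℝ) + t ≤ 0 := by linarith
    rw [hweight hk.ne, ← hsplit]
    refine le_trans ?_ (hD k)
    rw [abs_of_nonpos ha, hn.neg_pow]
    have := hn.pow_nonpos ha
    rw [abs_of_nonneg (by linarith)]
    linarith
  have habs : ∀ {k : ℤ}, 2 * |(k : ℝ)| - 1 ≤ |2 * (k : ℝ) + t| := by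
    intro k
    have h := abs_sub_abs_le_abs_sub (2 * (k : ℝ)) (-t)
    rw [abs_neg, sub_neg_eq_add, abs_mul, abs_two] at h
    linarith
  have htail : ∀ {k : ℤ} {m : ℕ} {B : ℝ}, 2 ≤ |k| → 2 ≤ m → 0 ≤ B → B ≤ 3 ^ (m - 2) →
      B ≤ tail k * |2 * (k : ℝ) + t| ^ m := by
    intro k m B hk hm hB hB3
    have hk2 : (2 : ℝ) ≤ |(k : ℝ)| := by exact_mod_cast hk
    have hb := habs (k := k)
    have hd : 0 < 2 * |(k : ℝ)| - 1 := by linarith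
    rw [tail, if_pos hk, one_div_mul_eq_div, le_div_iff₀ (by positivity),
      ← Nat.sub_add_cancel hm, pow_add]
    gcongr
    refine hB3.trans ?_
    gcongr
    linarith
  have hpos : ∀ {k : ℤ}, 0 < k → 1 ≤ 2 * (k : ℝ) + t := by
    intro k hk
    have : (1 : ℝ) ≤ k := by exact_mod_cast hk
    linarith
  have close_one : ∀ {w q τ A : ℝ}, 0 ≤ w → 0 ≤ q → 0 ≤ τ → 1 ≤ A → w ≤ (w + q * τ) * A := by
    intro w q τ A hw hq hτ hA
    nlinarith [mul_nonneg hq hτ]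
  have close_tail : ∀ {w q τ A B : ℝ}, 0 ≤ w → 0 ≤ q → 0 ≤ A → B ≤ τ * A →
      q * B ≤ (w + q * τ) * A := by
    intro w q τ A B hw hq hA hB
    nlinarith [mul_nonneg hw hA, mul_le_mul_of_nonneg_left hB hq]
  by_cases hxt : x ≤ (2 + t) ^ n / 2
  -- Here `x` is at most half of every positive centre. With `c² ≤ 1/32`: `25/32 = c²/(1/5)²`, `1/8`
  -- comes from `u ≥ 1/2` at `k = 1`, `1/32` from `u ≥ 1` at `k = -1`. For `|k| ≥ 2`, `|2k+t|⁴ ≥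
  -- 9(2|k|-1)²` gives `1/72 = (4/32)/9`.
  · refine ⟨fun k => (if k = 0 then 25 / 32 else 0) + (if k = 1 then 1 / 8 else 0) +
      (if k = -1 then 1 / 32 else 0) + 1 / 72 * tail k, _, (((hasSum_ite_eq 0 (25 / 32)).add
        (hasSum_ite_eq 1 (1 / 8))).add (hasSum_ite_eq (-1) (1 / 32))).add (hTs.mul_left _),
        by linarith, fun k => ?_⟩
    have htk := tail_nonneg k
    beta_reduce
    rcases lt_trichotomy k 0 with hk | rfl | hk
    · refine helper (by positivity) (by positivity) (hneg hk) (hc.trans ?_)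
      rw [if_neg hk.ne, if_neg (by omega), ← pow_mul]
      split_ifs with h
      · have : 1 ≤ |2 * (k : ℝ) + t| ^ (2 * 2) := one_le_pow₀ (one_le_abs_two_mul_add ht hk.ne)
        exact (by norm_num : (1 : ℝ) / 32 ≤ 0 + 0 + 1 / 32).trans
          (close_one (by norm_num) (by norm_num) htk this)
      · have := htail (k := k) (m := 2 * 2) (B := 9) (by rw [abs_of_neg hk]; omega)
          (by norm_num) (by norm_num) (by norm_num)
        exact (by norm_num : (1 : ℝ) / 32 ≤ 1 / 72 * 9).trans
          (close_tail (by norm_num) (by norm_num) (by positivity) this)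
    · refine helper (by positivity) (by norm_num : (0 : ℝ) ≤ 1 / 5) (by simpa [weight] using h0)
        (hc.trans ?_)
      simp [tail]
      norm_num
    · have ha := hpos hk
      refine helper (u := |2 * (k : ℝ) + t| ^ 2 / 2) (by positivity) (by positivity) ?_
        (hc.trans ?_)
      · rw [hweight hk.ne', ← mul_div_assoc, ← hsplit, abs_of_pos (by linarith)]
        refine le_trans ?_ (hD k)
        have : (2 + t) ^ n ≤ (2 * (k : ℝ) + t) ^ n := by
          have hk' : (1 : ℝ) ≤ k := by exact_mod_cast hk
          gcongr
          · linarith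
          · linarith
        rw [abs_sub_comm]
        refine le_trans ?_ (le_abs_self _)
        linarith
      · rw [if_neg hk.ne', if_neg (by omega : k ≠ -1), div_pow, ← pow_mul, ← mul_div_assoc,
          le_div_iff₀ (by norm_num)]
        split_ifs with h
        · have : 1 ≤ |2 * (k : ℝ) + t| ^ (2 * 2) := one_le_pow₀ (one_le_abs_two_mul_add ht hk.ne')
          exact (by norm_num : (1 : ℝ) / 32 * 2 ^ 2 ≤ 0 + 1 / 8 + 0).trans
            (close_one (by norm_num) (by norm_num) htk this)
        · have := htail (k := k) (m := 2 * 2) (B := 9) (by rw [abs_of_pos hk]; omega)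
            (by norm_num) (by norm_num) (by norm_num)
          exact (by norm_num : (1 : ℝ) / 32 * 2 ^ 2 ≤ 1 / 72 * 9).trans
            (close_tail (by norm_num) (by norm_num) (by positivity) this)
  · push Not at hxt
    obtain ⟨r, hr0, hr⟩ : ∃ r : ℝ, 0 ≤ r ∧ r ^ n = x :=
      ⟨x ^ ((n : ℝ)⁻¹), by positivity, Real.rpow_inv_natCast_pow hx (by omega)⟩
    -- The points `2k+t` are 2 apart, so at most one is within distance less than 1 of `r =
    -- x^(1/n)`; if none is, `j = 0` is an arbitrary choice.
    obtain ⟨j, hj⟩ : ∃ j : ℤ, ∀ k : ℤ, |r - (2 * (k : ℝ) + t)| < 1 → k = j := by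
      by_cases hex : ∃ j : ℤ, |r - (2 * (j : ℝ) + t)| < 1
      · obtain ⟨j, hj⟩ := hex
        refine ⟨j, fun k hk => ?_⟩
        rw [abs_lt] at hj hk
        have hl : (k : ℝ) < j + 1 := by linarith
        have hg : (j : ℝ) < k + 1 := by linarith
        have hl' : k < j + 1 := by exact_mod_cast hl
        have hg' : j < k + 1 := by exact_mod_cast hg
        omega
      · exact ⟨0, fun k hk => absurd ⟨k, hk⟩ hex⟩
    -- Only the index `j` relies on a disk radius: `4/9 = (3/2)⁻²`, which also covers the radius
    -- factor `3/10` at `k = 1`. The other indices have `u ≥ 1`, and those with `|k| ≥ 2` have `u ≥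
    -- |2k+t|`.
    refine ⟨fun k => (if k = 0 then 1 / 32 else 0) + (if k = 1 then 1 / 32 else 0) +
      (if k = -1 then 1 / 32 else 0) + (if k = j then 4 / 9 else 0) + 1 / 32 * tail k, _,
        ((((hasSum_ite_eq 0 (1 / 32)).add (hasSum_ite_eq 1 (1 / 32))).add
        (hasSum_ite_eq (-1) (1 / 32))).add (hasSum_ite_eq j (4 / 9))).add (hTs.mul_left _),
        by linarith, fun k => ?_⟩
    have htk := tail_nonneg k
    have hj0 : (0 : ℝ) ≤ if k = j then 4 / 9 else 0 := by positivity
    beta_reduce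
    rcases lt_trichotomy k 0 with hk | rfl | hk
    · refine helper (by positivity) (by positivity) (hneg hk) (hc.trans ?_)
      rw [if_neg hk.ne, if_neg (by omega : k ≠ 1), ← pow_mul]
      by_cases h : k = -1
      · have : 1 ≤ |2 * (k : ℝ) + t| ^ (2 * 2) := one_le_pow₀ (one_le_abs_two_mul_add ht hk.ne)
        rw [if_pos h]
        exact (by linarith : (1 : ℝ) / 32 ≤ 0 + 0 + 1 / 32 + _).trans
          (close_one (by positivity) (by norm_num) htk this)
      · have := htail (k := k) (m := 2 * 2) (B := 1) (by rw [abs_of_neg hk]; omega)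
          (by norm_num) (by norm_num) (by norm_num)
        exact (by norm_num : (1 : ℝ) / 32 ≤ 1 / 32 * 1).trans
          (close_tail (by positivity) (by norm_num) (by positivity) this)
    · refine helper (u := 1) (by positivity) zero_le_one ?_ (hc.trans ?_)
      · rw [weight, if_pos rfl, one_mul]
        refine le_trans ?_ (hD 0)
        refine le_trans ?_ (le_abs_self _)
        rw [Int.cast_zero, mul_zero, zero_add]
        -- For `t ≤ 0` the two Bernoulli bounds add up to `(2+t)^n + (-t)^n ≥ 2`, hence `x - t^n ≥
        -- 1`.
        have b1 := one_add_mul_le_pow (a := 1 + t) (by linarith) n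
        have b2 := one_add_mul_le_pow (a := -t - 1) (by linarith) n
        rw [show 1 + (1 + t) = 2 + t by ring] at b1
        rw [show 1 + (-t - 1) = -t by ring, hn.neg_pow] at b2
        rcases le_or_gt t 0 with h0 | h0
        · have := hn.pow_nonpos h0
          linarith
        · have b3 : t ^ n ≤ 1 := pow_le_one₀ h0.le ht₂
          have b4 : (3 : ℝ) ≤ n := by exact_mod_cast h3
          have b5 : (2 : ℝ) ^ 3 ≤ (2 + t) ^ n :=
            (pow_le_pow_left₀ zero_le_two (by linarith) 3).trans
              (pow_le_pow_right₀ (by linarith) h3)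
          linarith
      · rw [if_pos rfl]
        simp [tail]
        split_ifs <;> norm_num
    · have ha := hpos hk
      have hW := hweight hk.ne'
      have hae : |2 * (k : ℝ) + t| = 2 * (k : ℝ) + t := abs_of_pos (by linarith)
      by_cases hrk : |r - (2 * (k : ℝ) + t)| < 1
      · have hkj := hj k hrk
        by_cases hk1 : k = 1
        · refine helper (u := 3 / 10) (by positivity) (by norm_num) ?_ (hc.trans ?_)
          · rw [hk1, mul_comm]
            exact h1
          · rw [if_neg hk.ne', if_pos hk1, if_neg (by omega), if_pos hkj]
            linarith
        · refine helper (u := 3 / 2 * c) (by positivity) (by positivity) ?_ ?_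
          · rw [mul_comm]
            exact h2 k (by rw [abs_of_pos hk]; omega)
          · rw [if_neg hk.ne', if_neg hk1, if_neg (by omega), if_pos hkj]
            nlinarith [sq_nonneg c]
      · refine helper (u := |2 * (k : ℝ) + t|) (by positivity) (by positivity) ?_ (hc.trans ?_)
        · refine le_trans ?_ (hD k)
          rw [hW, hae, ← hr]
          set a := 2 * (k : ℝ) + t
          have hap : 0 < a ^ (n - 2) * a := by positivity
          -- With `a = 2k+t` and `|r - a| ≥ 1`, one factor of `r^n` is off by at least 1 and the
          -- others err in the same direction, so `|r^n - a^n| ≥ a^(n-1)`.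
          push Not at hrk
          rcases le_abs'.mp hrk with h | h
          · have : r ^ n ≤ a ^ (n - 2) * a * (a - 1) := by
              have e : r ^ n = r ^ (n - 2) * r * r := by rw [hsplit]; ring
              rw [e]
              gcongr <;> linarith
            rw [abs_sub_comm]
            refine le_trans ?_ (le_abs_self _)
            rw [hsplit a]
            linarith
          · have : a ^ (n - 2) * a * (a + 1) ≤ r ^ n := by
              have e : r ^ n = r ^ (n - 2) * r * r := by rw [hsplit]; ring
              rw [e]
              gcongr <;> linarith
            refine le_trans ?_ (le_abs_self _)
            rw [hsplit a]
            linarith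
        · rw [if_neg hk.ne', if_neg (by omega : k ≠ -1)]
          by_cases hk1 : k = 1
          · have : 1 ≤ |2 * (k : ℝ) + t| ^ 2 := one_le_pow₀ (one_le_abs_two_mul_add ht hk.ne')
            rw [if_pos hk1]
            exact (by linarith : (1 : ℝ) / 32 ≤ 0 + 1 / 32 + 0 + _).trans
              (close_one (by positivity) (by norm_num) htk this)
          · have := htail (k := k) (m := 2) (B := 1) (by rw [abs_of_pos hk]; omega)
              (by norm_num) (by norm_num) (by norm_num)
            exact (by norm_num : (1 : ℝ) / 32 ≤ 1 / 32 * 1).trans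
              (close_tail (by positivity) (by norm_num) (by positivity) this)

/-- Negative `x` is reduced to positive `x` by the reflection `(x, t, k) ↦ (-x, -t, -k)`, as `n` is
odd. -/
lemma exists_majorant {n : ℕ} (hn : Odd n) (h3 : 3 ≤ n) {t c x : ℝ} (ht : |t| ≤ 1)
    (hc : c ^ 2 ≤ 1 / 32) (hc0 : 0 ≤ c) {D : ℤ → ℝ}
    (hD : ∀ k : ℤ, |x - (2 * (k : ℝ) + t) ^ n| ≤ D k) (h0 : 1 / 5 ≤ D 0)
    (h1 : ∀ k : ℤ, |k| = 1 → 3 / 10 * weight n t k ≤ D k)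
    (h2 : ∀ k : ℤ, 2 ≤ |k| → 3 / 2 * c * weight n t k ≤ D k) :
    ∃ (g : ℤ → ℝ) (S : ℝ), HasSum g S ∧ S < 1 ∧
      ∀ k, (c * weight n t k) ^ 2 ≤ g k * D k ^ 2 := by
  rcases le_total 0 x with hx | hx
  · exact exists_majorant_of_nonneg hn h3 ht hc hc0 hx hD h0 (h1 1 abs_one) h2
  · have hw : ∀ k, weight n (-t) k = weight n t (-k) := fun k => by
      rw [← weight_neg n t (-k), neg_neg]
    obtain ⟨g, S, hg, hS, h⟩ := exists_majorant_of_nonneg hn h3 (t := -t) (c := c) (x := -x)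
      (D := fun k => D (-k)) (by rwa [abs_neg]) hc hc0 (by linarith)
      (fun k => by
        have e := neg_two_mul_add_pow hn t (-k)
        rw [neg_neg] at e
        rw [e, sub_neg_eq_add, neg_add_eq_sub, abs_sub_comm]
        exact hD (-k)) (by simpa using h0)
      (by rw [hw]; exact h1 (-1) (by simp)) (fun k hk => by rw [hw]; exact h2 (-k) (by rwa [abs_neg]))
    refine ⟨fun k => g (-k), S, (Equiv.neg ℤ).hasSum_iff.mpr hg, hS, fun k => ?_⟩
    have := h (-k)
    rwa [hw, neg_neg] at this

end Sum

/-! ### Rescaling by `π^n` and conclusion -/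

lemma scaled_constC_sq_le {n : ℕ} (h3 : 3 ≤ n) {C : ℝ} (hC0 : 0 ≤ C)
    (hC : C ≤ Real.pi ^ 2 * (2 : ℝ) ^ (-(n : ℝ) + 1 / 2)) : (C / Real.pi ^ 2) ^ 2 ≤ 1 / 32 := by
  have hn : (3 : ℝ) ≤ n := by exact_mod_cast h3
  have h : C / Real.pi ^ 2 ≤ (2 : ℝ) ^ (-(5 / 2) : ℝ) := by
    rw [div_le_iff₀' (by positivity)]
    refine hC.trans ?_
    gcongr
    · norm_num
    · linarith
  calc (C / Real.pi ^ 2) ^ 2 ≤ ((2 : ℝ) ^ (-(5 / 2) : ℝ)) ^ 2 := by gcongr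
    _ = (2 : ℝ) ^ (-5 : ℝ) := by
      rw [← Real.rpow_natCast, ← Real.rpow_mul (by norm_num)]
      norm_num
    _ = 1 / 32 := by
      rw [Real.rpow_neg (by norm_num)]
      norm_num

lemma center_eq (n : ℕ) (t : ℝ) (k : ℤ) :
    (2 * Real.pi * k + Real.pi * t) ^ n = Real.pi ^ n * (2 * (k : ℝ) + t) ^ n := by
  rw [← mul_pow]
  ring

lemma diskRadius_eq {n : ℕ} (h3 : 3 ≤ n) (C t : ℝ) {k : ℤ} (hk : 2 ≤ |k|) :
    diskRadius n C t k = Real.pi ^ n * (3 / 2 * (C / Real.pi ^ 2) * weight n t k) := by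
  have h0 : k ≠ 0 := by rintro rfl; simp at hk
  have h1 : ¬(k = 1 ∨ k = -1) := by rintro (rfl | rfl) <;> simp at hk
  rw [diskRadius, weight, if_neg h0, if_neg h1, if_neg h0,
    show Real.pi ^ n = Real.pi ^ (n - 2) * Real.pi ^ 2 by rw [← pow_add]; congr 1; omega]
  field_simp

lemma two_le_abs {k : ℤ} (h0 : k ≠ 0) (h1 : ¬(k = 1 ∨ k = -1)) : 2 ≤ |k| := by
  rcases abs_cases k with ⟨h, _⟩ | ⟨h, _⟩ <;> omega

lemma diskRadius_le {n : ℕ} (h3 : 3 ≤ n) {C t : ℝ}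
    (hc : (C / Real.pi ^ 2) ^ 2 ≤ 1 / 32) (ht : |t| ≤ 1) (k : ℤ) :
    diskRadius n C t k ≤ Real.pi ^ n * scaledRadius n t k := by
  by_cases h0 : k = 0
  · rw [diskRadius, scaledRadius, if_pos h0, if_pos h0, mul_comm]
  by_cases h1 : k = 1 ∨ k = -1
  · rw [diskRadius, scaledRadius, if_neg h0, if_neg h0, if_pos h1, mul_comm]
  · rw [diskRadius_eq h3 C t (two_le_abs h0 h1)]
    have hw := weight_pos (n := n) ht k
    -- `c² ≤ 1/32 < 1/25` gives `c < 1/5`.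
    have hc' : 3 / 2 * (C / Real.pi ^ 2) ≤ 3 / 10 := by nlinarith
    rw [scaledRadius, if_neg h0]
    have e : weight n t k = |2 * (k : ℝ) + t| ^ (n - 2) := if_neg h0
    rw [← e]
    gcongr

lemma closure_disk_subset (n : ℕ) (C t : ℝ) (k : ℤ) :
    closure (disk n C t k) ⊆ Metric.closedBall
      (((2 * Real.pi * k + Real.pi * t) ^ n : ℝ) : ℂ) (diskRadius n C t k) := by
  refine closure_minimal (fun z hz => ?_) Metric.isClosed_closedBall
  rw [Metric.mem_closedBall, dist_eq_norm]
  exact le_of_lt hz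

lemma disjoint_closure_disk {n : ℕ} (hn : Odd n) (h3 : 3 ≤ n) {C t : ℝ}
    (hc : (C / Real.pi ^ 2) ^ 2 ≤ 1 / 32) (ht : |t| ≤ 1) {j k : ℤ} (hjk : j < k) :
    Disjoint (closure (disk n C t j)) (closure (disk n C t k)) := by
  refine (Metric.closedBall_disjoint_closedBall ?_).mono (closure_disk_subset n C t j)
    (closure_disk_subset n C t k)
  have h := pow_add_scaledRadius_lt hn h3 ht hjk
  have hj := diskRadius_le h3 hc ht j
  have hk := diskRadius_le h3 hc ht k
  have hpi : 0 < Real.pi ^ n := by positivity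
  have h' := mul_lt_mul_of_pos_left h hpi
  rw [dist_eq_norm, ← Complex.ofReal_sub, Complex.norm_real, Real.norm_eq_abs, center_eq,
    center_eq, abs_sub_comm]
  refine lt_of_lt_of_le ?_ (le_abs_self _)
  linarith

lemma exists_mem_disk_of_isEigenvalue {n : ℕ} (hn : Odd n) (h3 : 3 ≤ n) {p : ℕ → ℝ → ℂ}
    (hp : ∀ v ∈ Finset.Icc 2 n, IsCoefficient (n - v) (p v))
    (hc : (constC n p / Real.pi ^ 2) ^ 2 ≤ 1 / 32) (hC : constC n p ≠ 0) {t : ℝ} (ht : |t| ≤ 1)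
    {ε : ℝ} (hε : ε ∈ Set.Icc (0 : ℝ) 1) {lam : ℂ} (hlam : IsEigenvalue n p t ε lam) :
    ∃ k : ℤ, lam ∈ disk n (constC n p) t k := by
  obtain ⟨y, hy, hy0, he⟩ := hlam
  by_contra! hout
  have hpi : 0 < Real.pi ^ n := by positivity
  have hCpos : 0 < constC n p := (constC_nonneg n p).lt_of_ne' hC
  set c := constC n p / Real.pi ^ 2 with hcdef
  have hcpos : 0 < c := by positivity
  set D : ℤ → ℝ := fun k => ‖lam - (((2 * Real.pi * k + Real.pi * t) ^ n : ℝ) : ℂ)‖ / Real.pi ^ n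
    with hDdef
  have hout' : ∀ k, diskRadius n (constC n p) t k ≤ Real.pi ^ n * D k := fun k => by
    rw [hDdef, mul_div_cancel₀ _ hpi.ne']
    exact not_lt.mp (hout k)
  have h0 : 1 / 5 ≤ D 0 := by
    have h := hout' 0
    rw [diskRadius, if_pos rfl, mul_comm] at h
    exact le_of_mul_le_mul_left h hpi
  have h1 : ∀ k : ℤ, |k| = 1 → 3 / 10 * weight n t k ≤ D k := fun k hk => by
    have h := hout' k
    have hk0 : k ≠ 0 := by rintro rfl; simp at hk
    rw [diskRadius, if_neg hk0, if_pos (eq_or_eq_neg_of_abs_eq hk), mul_comm] at h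
    rw [weight, if_neg hk0]
    exact le_of_mul_le_mul_left h hpi
  have h2 : ∀ k : ℤ, 2 ≤ |k| → 3 / 2 * c * weight n t k ≤ D k := fun k hk => by
    have h := hout' k
    rw [diskRadius_eq h3 _ _ hk] at h
    exact le_of_mul_le_mul_left h hpi
  -- The centres are real, so the real part of `lam` already bounds the distances from below.
  have hD : ∀ k : ℤ, |lam.re / Real.pi ^ n - (2 * (k : ℝ) + t) ^ n| ≤ D k := fun k => by
    have h := Complex.abs_re_le_norm (lam - (((2 * Real.pi * k + Real.pi * t) ^ n : ℝ) : ℂ))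
    rw [Complex.sub_re, Complex.ofReal_re] at h
    rw [hDdef, le_div_iff₀ hpi, ← abs_of_pos hpi, ← abs_mul, sub_mul, abs_of_pos hpi,
      div_mul_cancel₀ _ hpi.ne', mul_comm (_ ^ n) (Real.pi ^ n), ← center_eq]
    exact h
  obtain ⟨g, S, hg, hS, hgD⟩ := exists_majorant hn h3 ht hc hcpos.le hD h0 h1 h2
  have hym : MemLp y 2 unitMeasure := by
    have h := hy.memLp_der (Nat.zero_le n)
    rwa [der_zero] at h
  have hYpos := l2norm_pos hym hy0
  -- For `|k| ≥ 2` this needs `C ≠ 0`: otherwise those disks are empty and `lam` could be a centre.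
  have hDpos : ∀ k, 0 < D k := fun k => by
    have hw := weight_pos (n := n) ht k
    by_cases hk0 : k = 0
    · subst hk0
      linarith
    by_cases hk1 : k = 1 ∨ k = -1
    · exact lt_of_lt_of_le (by positivity) (h1 k (by rcases hk1 with rfl | rfl <;> simp))
    · exact lt_of_lt_of_le (by positivity) (h2 k (two_le_abs hk0 hk1))
  have hcoeff : ∀ k, ‖coeff t y k‖ ^ 2 ≤ g k * l2norm y ^ 2 := fun k => by
    have h := hy.norm_sub_mul_norm_coeff_le ht hε hp he k
    have e₁ : ‖lam - ((freq t k ^ n : ℝ) : ℂ)‖ = Real.pi ^ n * D k := by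
      rw [hDdef, mul_div_cancel₀ _ hpi.ne', freq,
        show Real.pi * (2 * (k : ℝ) + t) = 2 * Real.pi * k + Real.pi * t by ring]
    have e₂ : Real.pi ^ (n - 2) * weight n t k * constC n p =
        Real.pi ^ n * (c * weight n t k) := by
      rw [hcdef, show Real.pi ^ n = Real.pi ^ (n - 2) * Real.pi ^ 2 by
        rw [← pow_add]; congr 1; omega]
      field_simp
    rw [e₁, e₂, mul_assoc, mul_assoc] at h
    have h' := pow_le_pow_left₀ (by have := hDpos k; positivity) (le_of_mul_le_mul_left h hpi) 2
    rw [mul_pow, mul_pow] at h'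
    refine le_of_mul_le_mul_left (h'.trans ?_) (pow_pos (hDpos k) 2)
    calc (c * weight n t k) ^ 2 * l2norm y ^ 2 ≤ g k * D k ^ 2 * l2norm y ^ 2 := by
          gcongr
          exact hgD k
      _ = D k ^ 2 * (g k * l2norm y ^ 2) := by ring
  have hle := hasSum_le hcoeff (hasSum_sq_coeff hym t) (hg.mul_right _)
  have hY2 : 0 < l2norm y ^ 2 := by positivity
  nlinarith

end OddOrderBloch

end

theorem theorem2 (n : ℕ) (hn : Odd n) (hn1 : 1 < n) (p : ℕ → ℝ → ℂ)
    (hp : ∀ v ∈ Finset.Icc 2 n, OddOrderBloch.IsCoefficient (n - v) (p v))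
    (hC : OddOrderBloch.constC n p ≤ Real.pi ^ 2 * (2 : ℝ) ^ (-(n : ℝ) + 1 / 2))
    (t : ℝ) (ht : t ∈ Set.Ioc (-1 : ℝ) 1) :
    (OddOrderBloch.constC n p ≠ 0 → ∀ ε ∈ Set.Icc (0 : ℝ) 1, ∀ lam : ℂ,
      OddOrderBloch.IsEigenvalue n p t ε lam →
        ∃ k : ℤ, lam ∈ OddOrderBloch.disk n (OddOrderBloch.constC n p) t k) ∧
    (∀ j k : ℤ, j ≠ k →
      Disjoint (closure (OddOrderBloch.disk n (OddOrderBloch.constC n p) t j))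
        (closure (OddOrderBloch.disk n (OddOrderBloch.constC n p) t k))) := by
  have h3 : 3 ≤ n := by
    obtain ⟨m, rfl⟩ := hn
    omega
  have ht' : |t| ≤ 1 := abs_le.mpr ⟨ht.1.le, ht.2⟩
  have hc := OddOrderBloch.scaled_constC_sq_le h3 (OddOrderBloch.constC_nonneg n p) hC
  refine ⟨fun hC0 ε hε lam hlam =>
    OddOrderBloch.exists_mem_disk_of_isEigenvalue hn h3 hp hc hC0 ht' hε hlam, fun j k hjk => ?_⟩
  rcases hjk.lt_or_gt with h | h
  · exact OddOrderBloch.disjoint_closure_disk hn h3 hc ht' h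
  · exact (OddOrderBloch.disjoint_closure_disk hn h3 hc ht' h).symm
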